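/- Let $K$ be a field and let $P$ be a finite poset with a least element $0_P$ such that for every $z\in P$ the interval $[0_P,z]$ is a distributive lattice (a \emph{locally distributive lattice}). For $z\in P$ let $$T_z = K[[0_P,z]]\,/\,\bigl(xy-(x\wedge y)(x\vee y) : x,y\in[0_P,z]\bigr),$$ the quotient of the polynomial ring on the elements of $[0_P,z]$, with meet and join taken in $[0_P,z]$, and graded by giving every element of $[0_P,z]$ degree $1$. For $z'\le z$ let $T_{z'z}\colon T_z\to T_{z'}$ be the graded $K$-algebra homomorphism sending $x$ to $x$ if $x\le z'$ and to $0$ otherwise. Let $\lim_P T$ be the inverse limit, that is, the $K$-algebra of families $(s_z)_{z\in P}\in\prod_z T_z$ with $T_{z'z}(s_z)=s_{z'}$ for all $z'\le z$, with degree-$d$ part the families all of whose members have degree $d$ ($d\in\mathbb Z$). For $x\in P$ let $\phi(x)\in\lim_P T$ be the family whose member in $T_z$ is the class of $x$ if $x\le z$, and $0$ otherwise. For $m\in\mathbb N^P$ put $\phi(m)=\prod_{x\in P}\phi(x)^{m(x)}$; it is called standard if $\operatorname{supp}(m)$ is a chain. Then: 1. With $\phi$, $\lim_P T$ is a $\mathbb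 Z$-graded algebra with straightening law (ASL) on $P^{\mathrm{op}}$ over $K$. That is, $\phi$ is injective; the degree parts above make $\lim_P T$ a $\mathbb Z$-graded $K$-algebra in which every $\phi(x)$ is homogeneous of positive degree (in fact of degree $1$); the standard monomials form a $K$-basis of $\lim_P T$; and if $x,y\in P$ are incomparable and $\phi(m)$ occurs with non-zero coefficient in the expansion of $\phi(x)\phi(y)$ in standard monomials, then $\operatorname{supp}(m)$ is non-empty and its maximal element $x_m$ satisfies $x<x_m$ and $y<x_m$. 2. The $K$-algebra homomorphism $K[P]\to\lim_P T$, $x\mapsto\phi(x)$, from the polynomial ring on the elements of $P$ is surjective, and its kernel $I_T$ is generated by the elements $$xy-(x\wedge y)\sum_z z\qquad(x,y\in P),$$ where $z$ ranges over all minimal upper bounds of $x$ and $y$ in $P$. The second term is zero if there are none; if there is one, then the meet $x\wedge y$ exists in $P$. 3. If $P$ is a simplicial poset, i.e. every interval $[0_P,z]$ is a Boolean algebra, let $\tilde A_P$ be Stanley's ring, the quotient of $K[P]$ by the ideal generated by $xy$ for all $x,y$ without a common upper bound and by $xy-(x\wedge y)\sum_z z$, with $z$ ranging over the minimal upper bounds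 of $x,y$, for all $x,y$ with a common upper bound. Then $\tilde A_P$ is an ASL on $P^{\mathrm{op}}$ with respect to the classes of the elements $x\in P$, and there is an isomorphism of $K$-algebras $\lim_P T\cong\tilde A_P$ sending $\phi(x)$ to the class of $x$ for every $x\in P$. -/

import Mathlib

noncomputable section

namespace GenHibi

open MvPolynomial

/-! ### Graded algebras over a finite poset and their rings of global sections -/

/-- A `ℤ`-graded `KP`-algebra: `ℤ`-graded `K`-algebras `T_x` for `x ∈ P` and graded
`K`-algebra homomorphisms `T_{xy} : T_y → T_x` for `x ≤ y`, functorial in the pair. -/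
structure PosetAlgebra (K : Type*) [Field K] (P : Type*) [PartialOrder P] where
  stalk : P → Type*
  [commRing : ∀ x, CommRing (stalk x)]
  [algebra : ∀ x, Algebra K (stalk x)]
  /-- `grading x d` is the homogeneous part of degree `d` of the stalk at `x`. -/
  grading : ∀ x, ℤ → Submodule K (stalk x)
  graded : ∀ x, Nonempty (GradedAlgebra (grading x))
  /-- The restriction homomorphism `T_{xy} : T_y → T_x`. -/
  res : ∀ {x y : P}, x ≤ y → (stalk y →ₐ[K] stalk x)
  res_mem : ∀ {x y : P} (h : x ≤ y) (d : ℤ) (s : stalk y), s ∈ grading y d → res h s ∈ grading x d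
  res_refl : ∀ x : P, res (le_refl x) = AlgHom.id K (stalk x)
  res_comp : ∀ {x y z : P} (h : x ≤ y) (h' : y ≤ z), (res h).comp (res h') = res (h.trans h')

attribute [instance] PosetAlgebra.commRing PosetAlgebra.algebra

/-- The inverse limit `lim_P T`: compatible families of elements of the stalks. -/
def PosetAlgebra.lim {K : Type*} [Field K] {P : Type*} [PartialOrder P] (T : PosetAlgebra K P) :
    Subalgebra K (∀ x, T.stalk x) where
  carrier := {s | ∀ (x y : P) (h : x ≤ y), T.res h (s y) = s x}
  mul_mem' := fun ha hb x y h => by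
    rw [Pi.mul_apply, Pi.mul_apply, map_mul, ha x y h, hb x y h]
  add_mem' := fun ha hb x y h => by
    rw [Pi.add_apply, Pi.add_apply, map_add, ha x y h, hb x y h]
  algebraMap_mem' := fun r x y h => by
    rw [Pi.algebraMap_apply, Pi.algebraMap_apply, AlgHom.commutes]

/-- The part of degree `d` of `lim_P T`: the families all of whose members have degree `d`. -/
def PosetAlgebra.limGrading {K : Type*} [Field K] {P : Type*} [PartialOrder P]
    (T : PosetAlgebra K P) (d : ℤ) : Submodule K T.lim where
  carrier := {s | ∀ x, s.1 x ∈ T.grading x d}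
  add_mem' := fun ha hb x => (T.grading x d).add_mem (ha x) (hb x)
  zero_mem' := fun x => (T.grading x d).zero_mem
  smul_mem' := fun c _ ha x => (T.grading x d).smul_mem c (ha x)

/-! ### Algebras with straightening law -/

/-- The monomial `φ(m) = ∏ φ(x) ^ m(x)` of `R` attached to `m ∈ ℕ^P`. -/
def monomialOf {P R : Type*} [CommRing R] (φ : P → R) (m : P →₀ ℕ) : R :=
  m.prod fun x k => φ x ^ k

/-- The standard monomials on `P`: those whose support is a chain. -/
abbrev StdMonomial (P : Type*) [PartialOrder P] : Type _ :=
  {m : P →₀ ℕ // IsChain (· ≤ ·) (m.support : Set P)}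

/-- `R`, with `φ : P → R`, is an algebra with straightening law on `P^op` over `K`. -/
structure IsASLOnOp (K : Type*) [Field K] {P : Type*} [PartialOrder P] {R : Type*} [CommRing R]
    [Algebra K R] (φ : P → R) : Prop where
  injective : Function.Injective φ
  /-- The standard monomials are linearly independent ... -/
  linearIndependent : LinearIndependent K fun m : StdMonomial P => monomialOf φ m.1
  /-- ... and span `R`, so that they are a `K`-basis. -/
  span_eq_top : Submodule.span K (Set.range fun m : StdMonomial P => monomialOf φ m.1) = ⊤
  /-- If `x, y` are incomparable and `xy = ∑ r_m φ(m)` is written in standard monomials, then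
  `r_m ≠ 0` implies that the maximal element `w` of the support of `m` satisfies `x, y < w`. -/
  straightening : ∀ x y : P, ¬ x ≤ y → ¬ y ≤ x → ∀ r : StdMonomial P →₀ K,
    φ x * φ y = r.sum (fun m c => c • monomialOf φ m.1) →
    ∀ m, r m ≠ 0 → ∃ w, IsGreatest (m.1.support : Set P) w ∧ x < w ∧ y < w

/-- `R` is a `ℤ`-graded ASL on `P^op`: an ASL with a grading of the `K`-algebra `R` in which every
element of `P` is homogeneous of positive degree. -/
structure IsGradedASLOnOp (K : Type*) [Field K] {P : Type*} [PartialOrder P] {R : Type*}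
    [CommRing R] [Algebra K R] (𝒜 : ℤ → Submodule K R) (φ : P → R) : Prop where
  isASL : IsASLOnOp K φ
  graded : Nonempty (GradedAlgebra 𝒜)
  pos_degree : ∀ x, ∃ d : ℤ, 0 < d ∧ φ x ∈ 𝒜 d

/-! ### Locally distributive lattices and simplicial posets -/

/-- Every interval `[0_P, z]`, with the order induced from `P`, is a distributive lattice. -/
def IsLocallyDistributive (P : Type*) [PartialOrder P] [OrderBot P] : Prop :=
  ∀ z : P, ∃ L : DistribLattice (Set.Icc ⊥ z), ∀ a b, L.le a b ↔ (a : P) ≤ (b : P)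

/-- Every interval `[0_P, z]`, with the order induced from `P`, is a Boolean algebra. -/
def IsSimplicialPoset (P : Type*) [PartialOrder P] [OrderBot P] : Prop :=
  ∀ z : P, ∃ L : BooleanAlgebra (Set.Icc ⊥ z), ∀ a b, L.le a b ↔ (a : P) ≤ (b : P)

/-! ### Hibi rings -/

/-- The ideal of `K[L]` generated by all `x y - (x ∧ y) (x ∨ y)`. -/
def hibiIdeal (K : Type*) [Field K] (L : Type*) [PartialOrder L] : Ideal (MvPolynomial L K) :=
  Ideal.span {f | ∃ x y m j : L, IsGLB {x, y} m ∧ IsLUB {x, y} j ∧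
    f = X x * X y - X m * X j}

/-- The Hibi ring `K[L] / (x y - (x ∧ y) (x ∨ y))` of a lattice `L`. -/
abbrev HibiRing (K : Type*) [Field K] (L : Type*) [PartialOrder L] : Type _ :=
  MvPolynomial L K ⧸ hibiIdeal K L

/-- The standard grading of the Hibi ring: every element of `L` has degree `1`. -/
def hibiGrading (K : Type*) [Field K] (L : Type*) [PartialOrder L] (d : ℤ) :
    Submodule K (HibiRing K L) :=
  (weightedHomogeneousSubmodule K (fun _ : L => (1 : ℤ)) d).map
    (Ideal.Quotient.mkₐ K (hibiIdeal K L)).toLinearMap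

theorem hibiIdeal_component_mem (K : Type*) [Field K] (L : Type*) [PartialOrder L]
    {f : MvPolynomial L K} (hf : f ∈ hibiIdeal K L) (d : ℤ) :
    weightedHomogeneousComponent (fun _ : L => (1 : ℤ)) d f ∈ hibiIdeal K L := by
  let _ : GradedAlgebra (weightedHomogeneousSubmodule K (fun _ : L => (1 : ℤ))) :=
    weightedGradedAlgebra K _
  refine weightedHomogeneousComponent_mem_of_mem K _ ?_ hf d
  refine Ideal.homogeneous_span _ _ ?_
  rintro _ ⟨x, y, m, j, -, -, rfl⟩
  exact ⟨1 + 1, ((isWeightedHomogeneous_X K _ x).mul (isWeightedHomogeneous_X K _ y)).sub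
    ((isWeightedHomogeneous_X K _ m).mul (isWeightedHomogeneous_X K _ j))⟩

theorem hibiGrading_graded (K : Type*) [Field K] (L : Type*) [PartialOrder L] :
    Nonempty (GradedAlgebra (hibiGrading K L)) := by
  classical
  let : GradedAlgebra (weightedHomogeneousSubmodule K (fun _ : L => (1 : ℤ))) :=
    weightedGradedAlgebra K _
  have hm : SetLike.GradedMonoid (hibiGrading K L) :=
    { one_mem := ⟨1, isWeightedHomogeneous_one K _, map_one (Ideal.Quotient.mk (hibiIdeal K L))⟩
      mul_mem := by
        rintro i j _ _ ⟨f, hf, rfl⟩ ⟨g, hg, rfl⟩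
        exact ⟨f * g, IsWeightedHomogeneous.mul hf hg,
          map_mul (Ideal.Quotient.mk (hibiIdeal K L)) _ _⟩ }
  have hint : DirectSum.IsInternal (hibiGrading K L) := by
    have hπ : ∀ d : ℤ, ∃ π : HibiRing K L →ₗ[K] HibiRing K L, ∀ f,
        π (Ideal.Quotient.mk _ f) =
          Ideal.Quotient.mk _ (weightedHomogeneousComponent (fun _ : L => (1 : ℤ)) d f) := by
      intro d
      refine ⟨((hibiIdeal K L).restrictScalars K).mapQ ((hibiIdeal K L).restrictScalars K)
        (weightedHomogeneousComponent (fun _ : L => (1 : ℤ)) d)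
        (fun f hf => hibiIdeal_component_mem K L hf d), fun f => rfl⟩
    choose π hπ using hπ
    rw [DirectSum.isInternal_submodule_iff_iSupIndep_and_iSup_eq_top]
    constructor
    · intro d
      rw [Submodule.disjoint_def]
      rintro a ⟨f, hf, rfl⟩ ha
      have h1 : π d (Ideal.Quotient.mk _ f) = Ideal.Quotient.mk _ f := by
        rw [hπ, IsWeightedHomogeneous.weightedHomogeneousComponent_same hf]
      have h2 : (⨆ (e) (_ : e ≠ d), hibiGrading K L e) ≤ LinearMap.ker (π d) := by
        refine iSup₂_le fun e he => ?_
        rintro _ ⟨g, hg, rfl⟩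
        change π d (Ideal.Quotient.mk _ g) = 0
        rw [hπ, IsWeightedHomogeneous.weightedHomogeneousComponent_ne _ hg he.symm, map_zero]
      exact h1.symm.trans (h2 ha)
    · rw [eq_top_iff]
      rintro a -
      obtain ⟨f, rfl⟩ := Ideal.Quotient.mk_surjective a
      induction f using MvPolynomial.induction_on' with
      | monomial u c =>
        exact Submodule.mem_iSup_of_mem _
          ⟨monomial u c, isWeightedHomogeneous_monomial _ u c rfl, rfl⟩
      | add p q hp hq => rw [map_add]; exact Submodule.add_mem _ hp hq
  let := hint.chooseDecomposition
  exact ⟨{ hm, hint.chooseDecomposition with }⟩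

open Classical in
/-- The projection `K[[0_P, z]] → K[[0_P, z']]` that keeps the variables `x ≤ z'` and sends the
others to `0`. -/
def polyProj (K : Type*) [Field K] {P : Type*} [PartialOrder P] [OrderBot P] (z' z : P) :
    MvPolynomial (Set.Icc ⊥ z) K →ₐ[K] MvPolynomial (Set.Icc ⊥ z') K :=
  aeval fun x => if h : x.1 ≤ z' then X ⟨x.1, Set.mem_Icc.2 ⟨bot_le, h⟩⟩ else 0

theorem polyProj_X_pos (K : Type*) [Field K] {P : Type*} [PartialOrder P] [OrderBot P] {z' z : P}
    (x : Set.Icc ⊥ z) (h : x.1 ≤ z') : polyProj K z' z (X x) = X ⟨x.1, Set.mem_Icc.2 ⟨bot_le, h⟩⟩ := by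
  simp [polyProj, h]

theorem polyProj_X_neg (K : Type*) [Field K] {P : Type*} [PartialOrder P] [OrderBot P] {z' z : P}
    (x : Set.Icc ⊥ z) (h : ¬ x.1 ≤ z') : polyProj K z' z (X x) = 0 := by
  simp [polyProj, h]

theorem polyProj_mem (K : Type*) [Field K] {P : Type*} [PartialOrder P] [OrderBot P] {z' z : P}
    (hz : z' ≤ z) (f : MvPolynomial (Set.Icc ⊥ z) K) (hf : f ∈ hibiIdeal K (Set.Icc ⊥ z)) :
    polyProj K z' z f ∈ hibiIdeal K (Set.Icc ⊥ z') := by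
  suffices h : hibiIdeal K (Set.Icc ⊥ z) ≤
      (hibiIdeal K (Set.Icc ⊥ z')).comap (polyProj K z' z) from h hf
  refine Ideal.span_le.2 ?_
  rintro _ ⟨x, y, m, j, hm, hj, rfl⟩
  change polyProj K z' z _ ∈ hibiIdeal K (Set.Icc ⊥ z')
  have hxj : x ≤ j := hj.1 (by simp)
  have hyj : y ≤ j := hj.1 (by simp)
  have hmx : m ≤ x := hm.1 (by simp)
  have hmy : m ≤ y := hm.1 (by simp)
  rw [map_sub, map_mul, map_mul]
  by_cases hx : x.1 ≤ z'
  · by_cases hy : y.1 ≤ z'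
    · have hjz : j.1 ≤ z' := by
        have : j ≤ ⟨z', Set.mem_Icc.2 ⟨bot_le, hz⟩⟩ := hj.2 (by
          rintro w (rfl | rfl)
          · exact hx
          · exact hy)
        exact this
      have hmz : m.1 ≤ z' := le_trans hmx hx
      rw [polyProj_X_pos K x hx, polyProj_X_pos K y hy, polyProj_X_pos K m hmz,
        polyProj_X_pos K j hjz]
      refine Ideal.subset_span ⟨_, _, _, _, ⟨?_, ?_⟩, ⟨?_, ?_⟩, rfl⟩
      · rintro w (rfl | rfl)
        · exact hmx
        · exact hmy
      · intro w hw
        have h1 : w.1 ≤ x.1 := hw (Set.mem_insert _ _)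
        have h2 : w.1 ≤ y.1 := hw (Set.mem_insert_of_mem _ rfl)
        have : (⟨w.1, Set.mem_Icc.2 ⟨bot_le, w.2.2.trans hz⟩⟩ : Set.Icc ⊥ z) ≤ m := hm.2 (by
          rintro v (rfl | rfl)
          · exact h1
          · exact h2)
        exact this
      · rintro w (rfl | rfl)
        · exact hxj
        · exact hyj
      · intro w hw
        have h1 : x.1 ≤ w.1 := hw (Set.mem_insert _ _)
        have h2 : y.1 ≤ w.1 := hw (Set.mem_insert_of_mem _ rfl)
        have : j ≤ (⟨w.1, Set.mem_Icc.2 ⟨bot_le, w.2.2.trans hz⟩⟩ : Set.Icc ⊥ z) := hj.2 (by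
          rintro v (rfl | rfl)
          · exact h1
          · exact h2)
        exact this
    · rw [polyProj_X_neg K y hy, polyProj_X_neg K j fun h => hy (le_trans hyj h)]
      simp
  · rw [polyProj_X_neg K x hx, polyProj_X_neg K j fun h => hx (le_trans hxj h)]
    simp

/-- The restriction `T_{z'z} : T_z → T_{z'}` induced by `polyProj`. -/
def hibiRes (K : Type*) [Field K] {P : Type*} [PartialOrder P] [OrderBot P] {z' z : P}
    (hz : z' ≤ z) : HibiRing K (Set.Icc ⊥ z) →ₐ[K] HibiRing K (Set.Icc ⊥ z') :=
  Ideal.quotientMapₐ (hibiIdeal K (Set.Icc ⊥ z')) (polyProj K z' z) (polyProj_mem K hz)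

theorem hibiRes_mk (K : Type*) [Field K] {P : Type*} [PartialOrder P] [OrderBot P] {z' z : P}
    (hz : z' ≤ z) (f : MvPolynomial (Set.Icc ⊥ z) K) :
    hibiRes K hz (Ideal.Quotient.mk _ f) = Ideal.Quotient.mk _ (polyProj K z' z f) := rfl

theorem polyProj_homogeneous (K : Type*) [Field K] {P : Type*} [PartialOrder P] [OrderBot P]
    (z' z : P) (d : ℤ) (f : MvPolynomial (Set.Icc ⊥ z) K)
    (hf : IsWeightedHomogeneous (fun _ => (1 : ℤ)) f d) :
    IsWeightedHomogeneous (fun _ => (1 : ℤ)) (polyProj K z' z f) d := by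
  classical
  rw [f.as_sum, map_sum]
  refine IsWeightedHomogeneous.sum _ _ _ fun u hu => ?_
  have hd := hf (mem_support_iff.1 hu)
  rw [polyProj, aeval_monomial, algebraMap_eq]
  refine IsWeightedHomogeneous.C_mul ?_ _
  have := IsWeightedHomogeneous.prod (R := K) (w := fun _ : Set.Icc ⊥ z' => (1 : ℤ)) u.support
    (fun x => (if h : x.1 ≤ z' then X ⟨x.1, Set.mem_Icc.2 ⟨bot_le, h⟩⟩ else 0) ^ u x) (fun x => u x • (1 : ℤ))
    (fun x _ => by
      refine IsWeightedHomogeneous.pow ?_ _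
      split_ifs with h
      · exact isWeightedHomogeneous_X K _ _
      · exact isWeightedHomogeneous_zero K _ _)
  rw [← hd, Finsupp.weight_apply]
  exact this

/-- The `ℤ`-graded `KP`-algebra `T` with stalks the Hibi rings of the intervals `[0_P, z]`. -/
def hibiAlgebra (K : Type*) [Field K] (P : Type*) [PartialOrder P] [OrderBot P] :
    PosetAlgebra K P where
  stalk z := HibiRing K (Set.Icc ⊥ z)
  grading z := hibiGrading K (Set.Icc ⊥ z)
  graded z := hibiGrading_graded K (Set.Icc ⊥ z)
  res hz := hibiRes K hz
  res_mem := by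
    rintro x y h d _ ⟨f, hf, rfl⟩
    exact ⟨polyProj K x y f, polyProj_homogeneous K x y d f hf, rfl⟩
  res_refl z := by
    refine Ideal.Quotient.algHom_ext _ (MvPolynomial.algHom_ext fun x => ?_)
    change hibiRes K (le_refl z) (Ideal.Quotient.mk _ (X x)) = Ideal.Quotient.mk _ (X x)
    rw [hibiRes_mk, polyProj_X_pos K x x.2.2]
  res_comp := by
    intro x y z h h'
    refine Ideal.Quotient.algHom_ext _ (MvPolynomial.algHom_ext fun w => ?_)
    change hibiRes K h (hibiRes K h' (Ideal.Quotient.mk _ (X w))) =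
      hibiRes K (h.trans h') (Ideal.Quotient.mk _ (X w))
    rw [hibiRes_mk, hibiRes_mk, hibiRes_mk]
    by_cases hy : w.1 ≤ y
    · rw [polyProj_X_pos K w hy]
      by_cases hx : w.1 ≤ x
      · rw [polyProj_X_pos K w hx, polyProj_X_pos K ⟨w.1, Set.mem_Icc.2 ⟨bot_le, hy⟩⟩ hx]
      · rw [polyProj_X_neg K w hx, polyProj_X_neg K ⟨w.1, Set.mem_Icc.2 ⟨bot_le, hy⟩⟩ hx]
    · rw [polyProj_X_neg K w hy, polyProj_X_neg K w fun hx => hy (hx.trans h), map_zero]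

/-- The generalized Hibi ring `lim_P T`. -/
abbrev GenHibiRing (K : Type*) [Field K] (P : Type*) [PartialOrder P] [OrderBot P] : Type _ :=
  (hibiAlgebra K P).lim

open Classical in
/-- The family attached to `x ∈ P`: its member in `T_z` is the class of the variable `x` if
`x ≤ z`, and `0` otherwise. -/
def genFamily (K : Type*) [Field K] {P : Type*} [PartialOrder P] [OrderBot P] (x z : P) :
    HibiRing K (Set.Icc ⊥ z) :=
  if h : x ≤ z then Ideal.Quotient.mk _ (X ⟨x, Set.mem_Icc.2 ⟨bot_le, h⟩⟩) else 0

/-- The element of `lim_P T` given by `x ∈ P`. -/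
def gen (K : Type*) [Field K] {P : Type*} [PartialOrder P] [OrderBot P] (x : P) :
    GenHibiRing K P :=
  ⟨fun z => genFamily K x z, by
    intro z' z hz
    change hibiRes K hz (genFamily K x z) = genFamily K x z'
    by_cases h : x ≤ z'
    · rw [genFamily, genFamily, dif_pos (h.trans hz), dif_pos h, hibiRes_mk,
        polyProj_X_pos K _ h]
    · by_cases h' : x ≤ z
      · rw [genFamily, genFamily, dif_pos h', dif_neg h, hibiRes_mk, polyProj_X_neg K _ h, map_zero]
      · rw [genFamily, genFamily, dif_neg h', dif_neg h, map_zero]⟩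

/-! ### The relations -/

open Classical in
/-- The set of minimal upper bounds of `x` and `y` in the finite poset `P`. -/
def minUpperBounds {P : Type*} [PartialOrder P] [Fintype P] (x y : P) : Finset P :=
  Finset.univ.filter fun z => Minimal (fun w => x ≤ w ∧ y ≤ w) z

open Classical in
/-- The meet `x ∧ y` in `P`. In a locally distributive lattice it exists whenever `x` and `y` have
a common upper bound; where it does not exist, the value `0_P` is only ever multiplied by an
empty sum. -/
def meet {P : Type*} [PartialOrder P] [OrderBot P] (x y : P) : P :=
  if h : ∃ m, IsGLB {x, y} m then h.choose else ⊥

/-- `x y - (x ∧ y) ∑ z`, the sum being over all minimal upper bounds `z` of `x, y`. -/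
def relation (K : Type*) [Field K] {P : Type*} [PartialOrder P] [OrderBot P] [Fintype P]
    (x y : P) : MvPolynomial P K :=
  X x * X y - X (meet x y) * ∑ z ∈ minUpperBounds x y, X z

/-- Stanley's ideal of a simplicial poset: generated by the products `x y` where `x, y` have no
common upper bound, and by `x y - (x ∧ y) ∑ z`, with `z` running over the minimal upper bounds of
`x, y`, where they have one. -/
def stanleyIdeal (K : Type*) [Field K] (P : Type*) [PartialOrder P] [Fintype P] :
    Ideal (MvPolynomial P K) :=
  Ideal.span ({f | ∃ x y : P, ¬ BddAbove {x, y} ∧ f = X x * X y} ∪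
    {f | ∃ x y m : P, BddAbove {x, y} ∧ IsGLB {x, y} m ∧
      f = X x * X y - X m * ∑ z ∈ minUpperBounds x y, X z})

/-- Stanley's ring `Ã_P` of a simplicial poset (the variable `0_P` is not set to `1`). -/
abbrev StanleyRing (K : Type*) [Field K] (P : Type*) [PartialOrder P] [Fintype P] : Type _ :=
  MvPolynomial P K ⧸ stanleyIdeal K P

end GenHibi

end

/-! Everything rests on the standard monomials. In a stalk `T_w` those with a member of their
support outside `[0_P, w]` vanish, and the others form a basis. They span because `xy = (x ∧ y) ∑ z`
holds in every stalk (`genFamily_mul_genFamily`) and rewriting by it lowers a weight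
(`exists_potential`, `monomialOf_mem_span`). They are independent because of Birkhoff's embedding of
a distributive lattice: sending each element to the monomial of the minimal or sup-irreducible
elements below it respects the Hibi relations and separates multichains (`linearIndependent_hibi`).

The bases glue (`span_gen`). Restriction to a smaller stalk kills some standard monomials and keeps
the others, so in a compatible family the coefficient of `m` is the same in every stalk where `m`
survives. It can be read at the top of the support of `m`; since `P` is finite, these coefficients
form a finite combination equal to the family. Independence in the limit is also tested stalk by
stalk.

The rest is formal. The relation is already a straightening law, its right side being a sum of
standard monomials when `x, y` are incomparable. Modulo the relations every polynomial is a
combination of standard monomials, so independence in the limit determines the kernel. Stanley's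
ideal has the same generators. -/

namespace GenHibi

open MvPolynomial

/-! ### Monomials under homomorphisms. -/

section Monomials

variable {P R S : Type*} [CommRing R] [CommRing S]

theorem monomialOf_single (φ : P → R) (x : P) : monomialOf φ (Finsupp.single x 1) = φ x := by
  simp [monomialOf]

theorem monomialOf_add (φ : P → R) (m n : P →₀ ℕ) :
    monomialOf φ (m + n) = monomialOf φ m * monomialOf φ n := by
  classical
  exact Finsupp.prod_add_index' (fun _ => pow_zero _) fun _ _ _ => pow_add _ _ _

theorem map_monomialOf {F : Type*} [FunLike F R S] [RingHomClass F R S] (f : F) (φ : P → R)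
    (m : P →₀ ℕ) : f (monomialOf φ m) = monomialOf (fun x => f (φ x)) m := by
  simp [monomialOf, Finsupp.prod, map_prod]

theorem aeval_monomial_one {K : Type*} [Field K] [Algebra K R] (φ : P → R) (m : P →₀ ℕ) :
    aeval φ (monomial m (1 : K)) = monomialOf φ m := by
  rw [aeval_monomial, map_one, one_mul, monomialOf]

end Monomials

/-! ### Straightening terminates. -/

section Spanning

variable {P : Type*} [PartialOrder P]

/-- A weight that makes straightening terminate. No condition on `a` is needed: the drop comes from
`w` alone. -/
theorem exists_potential [Finite P] : ∃ ψ : P → ℕ, ∀ x y a w : P, x < w → y < w →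
    ψ a + ψ w < ψ x + ψ y := by
  classical
  have := Fintype.ofFinite P
  let h : P → ℕ := fun x => (Finset.univ.filter (· < x)).card
  have hle : ∀ x, 2 ^ h x ≤ 2 ^ Fintype.card P := fun x =>
    Nat.pow_le_pow_right two_pos (Finset.card_le_univ _)
  have hlt : ∀ x w, x < w → h x + 1 ≤ h w := fun x w hxw => by
    refine Finset.card_lt_card (Finset.ssubset_iff_of_subset ?_ |>.2 ⟨x, ?_, ?_⟩)
    · intro u hu
      simp only [Finset.mem_filter, Finset.mem_univ, true_and] at hu ⊢
      exact hu.trans hxw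
    · simpa using hxw
    · simp
  -- Since `h` is strictly monotone, `2 ^ h x + 2 ^ h y ≤ 2 ^ h w`, and `2 ^ h a > 0` makes the
  -- inequality strict. Subtracting from `2 ^ card P` reverses it; by `hle` the truncated
  -- subtraction is exact.
  refine ⟨fun x => 2 ^ Fintype.card P - 2 ^ h x, fun x y a w hx hy => ?_⟩
  have h1 := Nat.pow_le_pow_right two_pos (hlt x w hx)
  have h2 := Nat.pow_le_pow_right two_pos (hlt y w hy)
  rw [pow_succ] at h1 h2
  have h3 : 0 < 2 ^ h a := by positivity
  have := hle x; have := hle y; have := hle a; have := hle w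
  dsimp only
  omega

/-- If products of incomparable elements straighten, the standard monomials span all monomials. -/
theorem monomialOf_mem_span [Finite P] {K R : Type*} [Field K] [CommRing R] [Algebra K R]
    {φ : P → R}
    (hφ : ∀ x y : P, ¬ x ≤ y → ¬ y ≤ x →
      φ x * φ y ∈ Submodule.span K {r | ∃ a w, x < w ∧ y < w ∧ r = φ a * φ w})
    (m : P →₀ ℕ) :
    monomialOf φ m ∈ Submodule.span K (Set.range fun m : StdMonomial P => monomialOf φ m.1) := by
  classical
  obtain ⟨ψ, hψ⟩ := exists_potential (P := P)
  induction hn : m.sum (fun x k => k * ψ x) using Nat.strong_induction_on generalizing m with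
  | _ n ih =>
  have hadd : ∀ (m' : P →₀ ℕ) (u v : P),
      (m' + (Finsupp.single u 1 + Finsupp.single v 1)).sum (fun x k => k * ψ x) =
        m'.sum (fun x k => k * ψ x) + (ψ u + ψ v) := fun m' u v => by
    have h0 : ∀ x, 0 * ψ x = 0 := fun x => zero_mul _
    have h1 : ∀ x a b, (a + b) * ψ x = a * ψ x + b * ψ x := fun x a b => add_mul _ _ _
    rw [Finsupp.sum_add_index' h0 h1, Finsupp.sum_add_index' h0 h1]
    simp
  by_cases hm : IsChain (· ≤ ·) (m.support : Set P)
  · exact Submodule.subset_span ⟨⟨m, hm⟩, rfl⟩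
  · obtain ⟨x, hx, y, hy, hxy, hc⟩ : ∃ x ∈ m.support, ∃ y ∈ m.support, x ≠ y ∧
        ¬ (x ≤ y ∨ y ≤ x) := by
      simpa only [IsChain, Set.Pairwise, not_forall, exists_prop, Finset.mem_coe] using hm
    rw [not_or] at hc
    have hle : Finsupp.single x 1 + Finsupp.single y 1 ≤ m := by
      intro u
      have hx' := Finsupp.mem_support_iff.1 hx
      have hy' := Finsupp.mem_support_iff.1 hy
      simp only [Finsupp.add_apply, Finsupp.single_apply]
      split_ifs with h1 h2 h2
      · exact absurd (h1.trans h2.symm) hxy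
      · subst h1; omega
      · subst h2; omega
      · omega
    obtain ⟨m', rfl⟩ : ∃ m', m = m' + (Finsupp.single x 1 + Finsupp.single y 1) :=
      ⟨_, (tsub_add_cancel_of_le hle).symm⟩
    rw [monomialOf_add, monomialOf_add, monomialOf_single, monomialOf_single]
    -- Replacing the factor `xy` of the monomial by any `aw` in the span lowers the total
    -- `ψ`-weight, so the induction hypothesis covers each resulting term.
    have key : Submodule.span K {r | ∃ a w, x < w ∧ y < w ∧ r = φ a * φ w} ≤
        (Submodule.span K (Set.range fun m : StdMonomial P => monomialOf φ m.1)).comap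
          (LinearMap.mulLeft K (monomialOf φ m')) := by
      refine Submodule.span_le.2 ?_
      rintro _ ⟨a, w, hxw, hyw, rfl⟩
      have := ih _ (by
        rw [← hn, hadd, hadd]
        exact Nat.add_lt_add_left (hψ x y a w hxw hyw) _)
        (m' + (Finsupp.single a 1 + Finsupp.single w 1)) rfl
      rwa [monomialOf_add, monomialOf_add, monomialOf_single, monomialOf_single] at this
    exact key (hφ x y hc.1 hc.2)

theorem aeval_mem_span [Finite P] {K R : Type*} [Field K] [CommRing R] [Algebra K R]
    {φ : P → R}
    (hφ : ∀ x y : P, ¬ x ≤ y → ¬ y ≤ x →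
      φ x * φ y ∈ Submodule.span K {r | ∃ a w, x < w ∧ y < w ∧ r = φ a * φ w})
    (f : MvPolynomial P K) :
    aeval φ f ∈ Submodule.span K (Set.range fun m : StdMonomial P => monomialOf φ m.1) := by
  rw [f.as_sum, map_sum]
  refine Submodule.sum_mem _ fun m _ => ?_
  rw [← mul_one (coeff m f), ← smul_eq_mul, ← smul_monomial, map_smul, aeval_monomial_one]
  exact Submodule.smul_mem _ _ (monomialOf_mem_span hφ m)

/-- The witness is the top of the chain, or `⊥` for the monomial `1`. It marks the smallest interval
containing the support. -/
theorem exists_le_iff_support_le [OrderBot P] (m : StdMonomial P) :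
    ∃ t, ∀ z, (∀ x ∈ m.1.support, x ≤ z) ↔ t ≤ z := by
  rcases m.1.support.eq_empty_or_nonempty with h | h
  · exact ⟨⊥, fun z => by simp [h]⟩
  · obtain ⟨t, ht⟩ := m.1.support.exists_maximal h
    refine ⟨t, fun z => ⟨fun hz => hz t ht.1, fun hz x hx => le_trans ?_ hz⟩⟩
    rcases m.2.total hx ht.1 with h | h
    exacts [h, ht.2 hx h]

end Spanning

/-- Used for stalks, where many of the standard monomials of `P` are zero and their coefficients
carry no information. -/
theorem linearCombination_congr_of_eq_zero {ι K M : Type*} [Ring K] [AddCommGroup M] [Module K M]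
    {v : ι → M} {f g : ι →₀ K} (h : ∀ i, v i ≠ 0 → f i = g i) :
    Finsupp.linearCombination K v f = Finsupp.linearCombination K v g := by
  rw [← sub_eq_zero, ← map_sub, Finsupp.linearCombination_apply]
  refine Finset.sum_eq_zero fun i _ => ?_
  dsimp only
  by_cases hi : v i = 0
  · rw [hi, smul_zero]
  · rw [Finsupp.sub_apply, h i hi, sub_self, zero_smul]

/-! ### Independence of standard monomials in a Hibi ring. -/

section Hibi

variable {L : Type*}

/-- Möbius inversion by induction from the top: the values strictly above `y` are known, and what
remains of the sum is the value at `y`. -/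
theorem eq_of_sum_ge_eq [PartialOrder L] [Fintype L] [DecidableLE L] {m n : L →₀ ℕ}
    (h : ∀ y, ∑ x with y ≤ x, m x = ∑ x with y ≤ x, n x) : m = n := by
  classical
  ext y
  induction y using (wellFounded_gt (α := L)).induction with
  | _ y ih =>
  have hy : ∀ k : L →₀ ℕ, ∑ x with y ≤ x, k x = k y + ∑ x with y < x, k x := fun k => by
    rw [← Finset.sum_insert (by simp)]
    refine Finset.sum_congr ?_ fun _ _ => rfl
    ext x
    simp [le_iff_eq_or_lt, eq_comm]
  have h1 := h y
  rw [hy, hy, Finset.sum_congr rfl fun x hx => ih x (Finset.mem_filter.1 hx).2] at h1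
  exact Nat.add_right_cancel h1

/-- Within a chain, the elements above `p` and those above `q` are nested sets, so their
intersection is the smaller one. -/
theorem sum_sup_le_eq_min [Lattice L] [Fintype L] [DecidableLE L] {m : L →₀ ℕ}
    (hm : IsChain (· ≤ ·) (m.support : Set L)) (p q : L) :
    ∑ x with p ⊔ q ≤ x, m x = min (∑ x with p ≤ x, m x) (∑ x with q ≤ x, m x) := by
  classical
  have hmem : ∀ u, ∑ x with u ≤ x, m x = ∑ x ∈ m.support with u ≤ x, m x := fun u => by
    refine (Finset.sum_subset (fun x hx => ?_) fun x hx hx' => ?_).symm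
    · simp only [Finset.mem_filter, Finset.mem_univ, true_and] at hx ⊢
      exact hx.2
    · by_contra h0
      exact hx' (by simp_all)
  rw [hmem, hmem, hmem]
  have main : ∀ p q : L, (m.support.filter (p ≤ ·)) ⊆ m.support.filter (q ≤ ·) →
      ∑ x ∈ m.support with p ⊔ q ≤ x, m x =
        min (∑ x ∈ m.support with p ≤ x, m x) (∑ x ∈ m.support with q ≤ x, m x) := by
    intro p q hpq
    rw [min_eq_left (Finset.sum_le_sum_of_subset hpq)]
    refine Finset.sum_congr (Finset.filter_congr fun x hx => ?_) fun _ _ => rfl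
    refine ⟨fun h => le_sup_left.trans h, fun h => sup_le h ?_⟩
    exact (Finset.mem_filter.1 (hpq (Finset.mem_filter.2 ⟨hx, h⟩))).2
  by_cases hpq : (m.support.filter (p ≤ ·)) ⊆ m.support.filter (q ≤ ·)
  · exact main p q hpq
  · rw [sup_comm, min_comm]
    refine main q p fun x hx => ?_
    obtain ⟨y, hy, hy'⟩ := Finset.not_subset.1 hpq
    simp only [Finset.mem_filter, not_and] at hx hy hy' ⊢
    refine ⟨hx.1, ?_⟩
    rcases hm.total hx.1 hy.1 with h | h
    · exact absurd (hx.2.trans h) (hy' hy.1)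
    · exact hy.2.trans h

/-- A multichain is determined by the numbers of its elements above `p`, for `p` minimal or
sup-irreducible. -/
theorem eq_of_sum_ge_eq_of_isChain [Lattice L] [Fintype L] [DecidableLE L] {m n : L →₀ ℕ}
    (hm : IsChain (· ≤ ·) (m.support : Set L)) (hn : IsChain (· ≤ ·) (n.support : Set L))
    (h : ∀ p, IsMin p ∨ SupIrred p → ∑ x with p ≤ x, m x = ∑ x with p ≤ x, n x) : m = n := by
  refine eq_of_sum_ge_eq fun y => ?_
  induction y using (wellFounded_lt (α := L)).induction with
  | _ y ih =>
  by_cases hy : IsMin y ∨ SupIrred y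
  · exact h y hy
  · rw [not_or, SupIrred] at hy
    obtain ⟨h1, h2⟩ := hy
    push Not at h2
    -- Any other element is the join of two strictly smaller ones, whose counts are known by
    -- induction.
    obtain ⟨b, c, rfl, hb, hc⟩ := h2 h1
    rw [sum_sup_le_eq_min hm, sum_sup_le_eq_min hn, ih b (lt_of_le_of_ne le_sup_left hb),
      ih c (lt_of_le_of_ne le_sup_right hc)]

open Classical in
/-- The exponent vector of `x`: the set of minimal or sup-irreducible elements below `x`. -/
noncomputable def hibiExponent [Lattice L] [Fintype L] (x : L) : L →₀ ℕ :=
  Finsupp.equivFunOnFinite.symm fun p => if (IsMin p ∨ SupIrred p) ∧ p ≤ x then 1 else 0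

/-- Distributivity enters here: a sup-irreducible `p` is sup-prime, so `p ≤ x ⊔ y` means `p ≤ x` or
`p ≤ y`, and the identity is inclusion-exclusion. A minimal `p` lies below everything. -/
theorem hibiExponent_inf_add_sup [DistribLattice L] [Fintype L] (x y : L) :
    hibiExponent x + hibiExponent y = hibiExponent (x ⊓ y) + hibiExponent (x ⊔ y) := by
  classical
  ext p
  simp only [hibiExponent, Finsupp.add_apply, Finsupp.equivFunOnFinite_symm_apply_apply,
    le_inf_iff]
  by_cases hp : IsMin p ∨ SupIrred p
  · have hsup : p ≤ x ⊔ y ↔ p ≤ x ∨ p ≤ y := by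
      rcases hp with hp | hp
      · have : ∀ u, p ≤ u := fun u => (hp inf_le_left).trans (inf_le_right (a := p) (b := u))
        simp [this]
      · exact (supPrime_iff_supIrred.2 hp).le_sup
    by_cases h1 : p ≤ x <;> by_cases h2 : p ≤ y <;> simp [hp, hsup, h1, h2]
  · simp [hp]

theorem hibiExponent_sum_apply [Lattice L] [Fintype L] [DecidableLE L] (m : L →₀ ℕ) {p : L}
    (hp : IsMin p ∨ SupIrred p) :
    (m.sum fun x k => k • hibiExponent x) p = ∑ x with p ≤ x, m x := by
  classical
  rw [Finsupp.sum_fintype m (fun x k => k • hibiExponent x) (fun _ => zero_nsmul _),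
    Finsupp.finsetSum_apply, Finset.sum_filter]
  refine Finset.sum_congr rfl fun x _ => ?_
  simp [hibiExponent, hp]

theorem monomialOf_hibiExponent (K : Type*) [Field K] [Lattice L] [Fintype L] (m : L →₀ ℕ) :
    monomialOf (fun x : L => monomial (hibiExponent x) (1 : K)) m =
      monomial (m.sum fun x k => k • hibiExponent x) 1 := by
  simp only [monomialOf, Finsupp.prod, Finsupp.sum, monomial_pow, one_pow]
  rw [monomial_sum_one]

/-- The Hibi ring maps to a polynomial ring by `hibiExponent`. There a multichain becomes the
monomial whose exponent at `p` counts its members above `p`, so distinct multichains give distinct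
monomials. -/
theorem linearIndependent_hibi (K : Type*) [Field K] [i : PartialOrder L] [Finite L]
    (hL : ∃ D : DistribLattice L, ∀ a b, D.le a b ↔ a ≤ b) :
    LinearIndependent K fun m : StdMonomial L =>
      monomialOf (fun x => Ideal.Quotient.mk (hibiIdeal K L) (X x)) m.1 := by
  classical
  obtain ⟨D, hD⟩ := hL
  -- Identifying the two orders makes the lattice operations available without changing `hibiIdeal`.
  obtain rfl : i = D.toPartialOrder := PartialOrder.ext fun a b => (hD a b).symm
  have := Fintype.ofFinite L
  let g : MvPolynomial L K →ₐ[K] MvPolynomial L K :=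
    aeval fun x => monomial (hibiExponent x) 1
  have hg : ∀ f ∈ hibiIdeal K L, g f = 0 := by
    change hibiIdeal K L ≤ RingHom.ker g
    refine Ideal.span_le.2 ?_
    rintro _ ⟨x, y, m, j, hm, hj, rfl⟩
    obtain rfl := hm.unique isGLB_pair
    obtain rfl := hj.unique isLUB_pair
    change g _ = 0
    simp only [g, map_sub, map_mul, aeval_X, monomial_mul, mul_one]
    rw [hibiExponent_inf_add_sup, sub_self]
  let g' : HibiRing K L →ₐ[K] MvPolynomial L K := Ideal.Quotient.liftₐ _ g hg
  refine LinearIndependent.of_comp g'.toLinearMap ?_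
  have hval : (g'.toLinearMap ∘ fun m : StdMonomial L =>
      monomialOf (fun x => Ideal.Quotient.mk (hibiIdeal K L) (X x)) m.1) =
      basisMonomials L K ∘ fun m : StdMonomial L => m.1.sum fun x k => k • hibiExponent x := by
    funext m
    rw [Function.comp_apply, Function.comp_apply, AlgHom.toLinearMap_apply, map_monomialOf,
      coe_basisMonomials]
    refine Eq.trans ?_ (monomialOf_hibiExponent K m.1)
    congr 1
    funext x
    exact aeval_X _ x
  rw [hval]
  refine (basisMonomials L K).linearIndependent.comp _ fun m n hmn => Subtype.ext ?_
  refine eq_of_sum_ge_eq_of_isChain m.2 n.2 fun p hp => ?_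
  rw [← hibiExponent_sum_apply _ hp, ← hibiExponent_sum_apply _ hp]
  exact DFunLike.congr_fun hmn p

end Hibi

/-! ### Minimal upper bounds, and meets and joins in intervals. -/

theorem mem_minUpperBounds {P : Type*} [PartialOrder P] [Fintype P] {x y z : P} :
    z ∈ minUpperBounds x y ↔ Minimal (fun w => x ≤ w ∧ y ≤ w) z := by
  simp [minUpperBounds]

theorem lt_of_mem_minUpperBounds {P : Type*} [PartialOrder P] [Fintype P] {x y z : P}
    (hxy : ¬ x ≤ y) (hyx : ¬ y ≤ x) (hz : z ∈ minUpperBounds x y) : x < z ∧ y < z := by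
  obtain ⟨⟨h1, h2⟩, -⟩ := mem_minUpperBounds.1 hz
  exact ⟨lt_of_le_of_ne h1 fun h => hyx (h ▸ h2), lt_of_le_of_ne h2 fun h => hxy (h ▸ h1)⟩

theorem support_single_add_single_one {P : Type*} [DecidableEq P] (a b : P) :
    (Finsupp.single a 1 + Finsupp.single b 1 : P →₀ ℕ).support = {a, b} := by
  ext u
  by_cases h1 : a = u <;> by_cases h2 : b = u <;>
    simp [h1, h2, eq_comm (a := u)]

section Order

variable {P : Type*} [PartialOrder P] [OrderBot P]

theorem meet_eq_of_isGLB {x y m : P} (h : IsGLB {x, y} m) : meet x y = m := by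
  have h' : ∃ m, IsGLB {x, y} m := ⟨m, h⟩
  rw [meet, dif_pos h']
  exact h'.choose_spec.unique h

theorem IsLocallyDistributive.exists_isGLB_isLUB (hP : IsLocallyDistributive P) {w : P}
    (x y : Set.Icc ⊥ w) : ∃ m j, IsGLB {x, y} m ∧ IsLUB {x, y} j := by
  obtain ⟨D, hD⟩ := hP w
  obtain ⟨m, hm⟩ : ∃ m, m = D.inf x y := ⟨_, rfl⟩
  obtain ⟨j, hj⟩ : ∃ j, j = D.sup x y := ⟨_, rfl⟩
  refine ⟨m, j, ⟨?_, ?_⟩, ⟨?_, ?_⟩⟩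
  · rintro u (rfl | rfl)
    · exact (hD _ _).1 (hm ▸ D.inf_le_left _ _)
    · exact (hD _ _).1 (hm ▸ D.inf_le_right _ _)
  · intro u hu
    exact (hD _ _).1 (hm ▸ D.le_inf _ _ _ ((hD _ _).2 (hu (by simp))) ((hD _ _).2 (hu (by simp))))
  · rintro u (rfl | rfl)
    · exact (hD _ _).1 (hj ▸ D.le_sup_left _ _)
    · exact (hD _ _).1 (hj ▸ D.le_sup_right _ _)
  · intro u hu
    exact (hD _ _).1 (hj ▸ D.sup_le _ _ _ ((hD _ _).2 (hu (by simp))) ((hD _ _).2 (hu (by simp))))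

/-- Lower bounds in `P` of points of `[0_P, w]` already lie in the interval. The analogue for joins
fails, which is why several minimal upper bounds can occur. -/
theorem isGLB_of_Icc {w : P} {x y m : Set.Icc ⊥ w} (h : IsGLB {x, y} m) :
    IsGLB {x.1, y.1} m.1 := by
  refine ⟨?_, fun u hu => ?_⟩
  · rintro u (rfl | rfl)
    · exact h.1 (by simp)
    · exact h.1 (by simp)
  · have hux : u ≤ x.1 := hu (by simp)
    have huy : u ≤ y.1 := hu (by simp)
    have : (⟨u, bot_le, hux.trans x.2.2⟩ : Set.Icc ⊥ w) ≤ m := h.2 (by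
      rintro v (rfl | rfl)
      · exact hux
      · exact huy)
    exact this

theorem IsLocallyDistributive.exists_isGLB (hP : IsLocallyDistributive P) {x y w : P}
    (hx : x ≤ w) (hy : y ≤ w) : ∃ m, IsGLB {x, y} m := by
  obtain ⟨m, -, hm, -⟩ := hP.exists_isGLB_isLUB (w := w) ⟨x, bot_le, hx⟩ ⟨y, bot_le, hy⟩
  exact ⟨_, isGLB_of_Icc hm⟩

theorem le_of_isLUB_Icc {w : P} {x y j : Set.Icc ⊥ w} (h : IsLUB {x, y} j) {u : P} (hu : u ≤ w)
    (hx : x.1 ≤ u) (hy : y.1 ≤ u) : j.1 ≤ u := by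
  have : j ≤ (⟨u, bot_le, hu⟩ : Set.Icc ⊥ w) := h.2 (by
    rintro v (rfl | rfl)
    · exact hx
    · exact hy)
  exact this

/-- Each stalk sees at most one minimal upper bound; this reduces the sum in the relation to a
single Hibi term. -/
theorem mem_minUpperBounds_iff_of_isLUB [Fintype P] {w : P} {x y j : Set.Icc ⊥ w}
    (h : IsLUB {x, y} j) {z : P} (hz : z ≤ w) : z ∈ minUpperBounds x.1 y.1 ↔ z = j.1 := by
  have hxj : x.1 ≤ j.1 := h.1 (by simp : x ∈ ({x, y} : Set _))
  have hyj : y.1 ≤ j.1 := h.1 (by simp : y ∈ ({x, y} : Set _))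
  rw [mem_minUpperBounds]
  constructor
  · intro hm
    have hjz := le_of_isLUB_Icc h hz hm.1.1 hm.1.2
    exact le_antisymm (hm.2 ⟨hxj, hyj⟩ hjz) hjz
  · rintro rfl
    exact ⟨⟨hxj, hyj⟩, fun u hu huj => le_of_isLUB_Icc h (huj.trans hz) hu.1 hu.2⟩

end Order

/-! ### From the relations to a straightening law. -/

section Straightening

variable {K : Type*} [Field K] {P : Type*} [PartialOrder P] [OrderBot P] [Fintype P]
  {R : Type*} [CommRing R] [Algebra K R]

theorem mul_mem_span_of_mul_eq {φ : P → R}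
    (hφ : ∀ x y, φ x * φ y = φ (meet x y) * ∑ z ∈ minUpperBounds x y, φ z) (x y : P)
    (hxy : ¬ x ≤ y) (hyx : ¬ y ≤ x) :
    φ x * φ y ∈ Submodule.span K {r | ∃ a w, x < w ∧ y < w ∧ r = φ a * φ w} := by
  rw [hφ, Finset.mul_sum]
  refine Submodule.sum_mem _ fun z hz => Submodule.subset_span ?_
  obtain ⟨h1, h2⟩ := lt_of_mem_minUpperBounds hxy hyx hz
  exact ⟨_, _, h1, h2, rfl⟩

theorem IsLocallyDistributive.meet_le (hP : IsLocallyDistributive P) {x y z : P}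
    (hz : z ∈ minUpperBounds x y) : meet x y ≤ x := by
  obtain ⟨⟨h1, h2⟩, -⟩ := mem_minUpperBounds.1 hz
  obtain ⟨m, hm⟩ := hP.exists_isGLB h1 h2
  rw [meet_eq_of_isGLB hm]
  exact hm.1 (by simp)

/-- An algebra satisfying the relations `xy = (x ∧ y) ∑ z`, in which the standard monomials form a
basis, is an algebra with straightening law. -/
theorem isASLOnOp_of_mul_eq (hP : IsLocallyDistributive P) {φ : P → R}
    (hφ : ∀ x y, φ x * φ y = φ (meet x y) * ∑ z ∈ minUpperBounds x y, φ z)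
    (hli : LinearIndependent K fun m : StdMonomial P => monomialOf φ m.1)
    (hspan : Submodule.span K (Set.range fun m : StdMonomial P => monomialOf φ m.1) = ⊤) :
    IsASLOnOp K φ where
  injective x y h := by
    have hc : ∀ x : P, IsChain (· ≤ ·)
        ((Finsupp.single x 1 : P →₀ ℕ).support : Set P) := fun x => by
      rw [Finsupp.support_single _ one_ne_zero, Finset.coe_singleton]
      exact Set.subsingleton_singleton.isChain
    have := hli.injective (a₁ := ⟨_, hc x⟩) (a₂ := ⟨_, hc y⟩)
      (by simpa only [monomialOf_single] using h)
    exact Finsupp.single_left_injective one_ne_zero (Subtype.ext_iff.1 this)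
  linearIndependent := hli
  span_eq_top := hspan
  straightening x y hxy hyx r hr m hm := by
    classical
    have hsupp := support_single_add_single_one (meet x y)
    have hlt : ∀ z ∈ minUpperBounds x y, meet x y < z := fun z hz =>
      lt_of_le_of_lt (hP.meet_le hz) (lt_of_mem_minUpperBounds hxy hyx hz).1
    have hc : ∀ z : minUpperBounds x y, IsChain (· ≤ ·)
        ((Finsupp.single (meet x y) 1 + Finsupp.single z.1 1 : P →₀ ℕ).support : Set P) := by
      intro z
      rw [hsupp, Finset.coe_pair]
      exact IsChain.pair (hlt z.1 z.2).le
    let s : StdMonomial P →₀ K :=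
      ∑ z : minUpperBounds x y, Finsupp.single ⟨_, hc z⟩ 1
    have hs : φ x * φ y = Finsupp.linearCombination K
        (fun m : StdMonomial P => monomialOf φ m.1) s := by
      rw [hφ, map_sum, Finset.mul_sum, ← Finset.sum_coe_sort]
      refine Finset.sum_congr rfl fun z _ => ?_
      rw [Finsupp.linearCombination_single, one_smul, monomialOf_add, monomialOf_single,
        monomialOf_single]
    -- Independence makes the expansion unique, so the given `r` is the one supplied by the
    -- relation, with supports `{x ∧ y, z}`.
    have hrs : r = s := hli (by rw [← hs, hr]; rfl)
    rw [hrs, Finsupp.finsetSum_apply] at hm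
    obtain ⟨z, -, hz⟩ := Finset.exists_ne_zero_of_sum_ne_zero hm
    obtain rfl : _ = m := by
      by_contra hne
      exact hz (Finsupp.single_eq_of_ne' hne)
    have := lt_of_mem_minUpperBounds hxy hyx z.2
    refine ⟨z.1, ⟨?_, ?_⟩, this⟩
    · simp [hsupp]
    · intro u hu
      rw [hsupp, Finset.coe_pair] at hu
      rcases hu with rfl | rfl
      exacts [(hlt z.1 z.2).le, le_rfl]

end Straightening

/-! ### Standard monomials of `P` in a single stalk. -/

section Stalks

variable (K : Type*) [Field K] {P : Type*} [PartialOrder P] [OrderBot P]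

theorem genFamily_of_le {x z : P} (h : x ≤ z) :
    genFamily K x z = Ideal.Quotient.mk _ (X ⟨x, Set.mem_Icc.2 ⟨bot_le, h⟩⟩) := dif_pos h

theorem genFamily_of_not_le {x z : P} (h : ¬ x ≤ z) : genFamily K x z = 0 := dif_neg h

/-- If `x, y ≤ w`, only their join in `[0_P, w]` survives in the sum and the claim is a Hibi
relation. Otherwise no common upper bound lies below `w`, and both sides vanish. -/
theorem genFamily_mul_genFamily [Fintype P] (hP : IsLocallyDistributive P) (w x y : P) :
    genFamily K x w * genFamily K y w =
      genFamily K (meet x y) w * ∑ z ∈ minUpperBounds x y, genFamily K z w := by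
  classical
  by_cases h : x ≤ w ∧ y ≤ w
  · obtain ⟨hx, hy⟩ := h
    obtain ⟨m, j, hm, hj⟩ := hP.exists_isGLB_isLUB (w := w) ⟨x, bot_le, hx⟩ ⟨y, bot_le, hy⟩
    rw [Finset.sum_eq_single j.1, meet_eq_of_isGLB (isGLB_of_Icc hm), genFamily_of_le K hx,
      genFamily_of_le K hy, genFamily_of_le K m.2.2, genFamily_of_le K j.2.2, ← map_mul,
      ← map_mul]
    · exact Ideal.Quotient.eq.2 (Ideal.subset_span ⟨_, _, _, _, hm, hj, rfl⟩)
    · intro z hz hzj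
      exact genFamily_of_not_le K fun hzw => hzj ((mem_minUpperBounds_iff_of_isLUB hj hzw).1 hz)
    · intro hj'
      exact absurd ((mem_minUpperBounds_iff_of_isLUB hj j.2.2).2 rfl) hj'
  · have h0 : genFamily K x w * genFamily K y w = 0 := by
      rw [not_and_or] at h
      rcases h with h | h
      · rw [genFamily_of_not_le K h, zero_mul]
      · rw [genFamily_of_not_le K h, mul_zero]
    rw [h0, Finset.sum_eq_zero, mul_zero]
    intro z hz
    obtain ⟨⟨h1, h2⟩, -⟩ := mem_minUpperBounds.1 hz
    exact genFamily_of_not_le K fun hzw => h ⟨h1.trans hzw, h2.trans hzw⟩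

theorem aeval_genFamily_surjective (w : P) :
    Function.Surjective (aeval (fun x => genFamily K x w) :
      MvPolynomial P K →ₐ[K] HibiRing K (Set.Icc ⊥ w)) := by
  intro s
  obtain ⟨f, rfl⟩ := Ideal.Quotient.mk_surjective s
  refine ⟨rename Subtype.val f, ?_⟩
  rw [aeval_rename]
  have : (aeval ((fun x => genFamily K x w) ∘ Subtype.val) :
      MvPolynomial (Set.Icc ⊥ w) K →ₐ[K] HibiRing K (Set.Icc ⊥ w)) =
      Ideal.Quotient.mkₐ K (hibiIdeal K (Set.Icc ⊥ w)) := by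
    refine MvPolynomial.algHom_ext fun x => ?_
    rw [aeval_X, Function.comp_apply, genFamily_of_le K x.2.2]
    rfl
  rw [this]
  rfl

theorem span_genFamily [Fintype P] (hP : IsLocallyDistributive P) (w : P) :
    Submodule.span K (Set.range fun m : StdMonomial P =>
      monomialOf (fun x => genFamily K x w) m.1) = ⊤ := by
  refine eq_top_iff.2 fun s _ => ?_
  obtain ⟨f, rfl⟩ := aeval_genFamily_surjective K w s
  exact aeval_mem_span (mul_mem_span_of_mul_eq (genFamily_mul_genFamily K hP w)) f

theorem monomialOf_genFamily_eq_zero {w : P} {m : P →₀ ℕ} (hm : ¬ ∀ x ∈ m.support, x ≤ w) :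
    monomialOf (fun x => genFamily K x w) m = 0 := by
  push Not at hm
  obtain ⟨x, hx, hxw⟩ := hm
  refine Finset.prod_eq_zero hx ?_
  dsimp only
  rw [genFamily_of_not_le K hxw, zero_pow (Finsupp.mem_support_iff.1 hx)]

theorem monomialOf_genFamily {w : P} {m : P →₀ ℕ} (hm : ∀ x ∈ m.support, x ≤ w) :
    monomialOf (fun x => genFamily K x w) m =
      monomialOf (fun x => Ideal.Quotient.mk (hibiIdeal K (Set.Icc ⊥ w)) (X x))
        (m.comapDomain Subtype.val Subtype.val_injective.injOn) := by
  refine (Finset.prod_nbij Subtype.val (fun x hx => ?_) Subtype.val_injective.injOn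
    (fun x hx => ?_) fun x _ => ?_).symm
  · simpa using hx
  · exact ⟨⟨x, bot_le, hm x hx⟩, by simpa using hx, rfl⟩
  · dsimp only
    rw [Finsupp.comapDomain_apply, genFamily_of_le K x.2.2]

/-- In the stalk at `w`, the standard monomials with support below `w` are linearly independent. -/
theorem coeff_eq_zero_of_linearCombination_genFamily [Finite P] (hP : IsLocallyDistributive P)
    {w : P} {f : StdMonomial P →₀ K}
    (hf : Finsupp.linearCombination K (fun m : StdMonomial P =>
      monomialOf (fun x => genFamily K x w) m.1) f = 0)
    (m : StdMonomial P) (hm : ∀ x ∈ m.1.support, x ≤ w) : f m = 0 := by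
  classical
  let S : Set (StdMonomial P) := {m | ∀ x ∈ m.1.support, x ≤ w}
  -- Monomials supported below `w` are regarded as monomials on the interval, where
  -- `linearIndependent_hibi` applies.
  let c : S → StdMonomial (Set.Icc ⊥ w) := fun m =>
    ⟨m.1.1.comapDomain Subtype.val Subtype.val_injective.injOn, fun x hx y hy hxy =>
      m.1.2 (by simpa using hx) (by simpa using hy) fun h => hxy (Subtype.ext h)⟩
  have hc : Function.Injective c := by
    intro a b hab
    refine Subtype.ext (Subtype.ext (Finsupp.ext fun x => ?_))
    by_cases hx : x ≤ w
    · exact DFunLike.congr_fun (congrArg Subtype.val hab) ⟨x, bot_le, hx⟩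
    · rw [Finsupp.notMem_support_iff.1 fun h => hx (a.2 x h),
        Finsupp.notMem_support_iff.1 fun h => hx (b.2 x h)]
  have hli : LinearIndepOn K (fun m : StdMonomial P =>
      monomialOf (fun x => genFamily K x w) m.1) S := by
    have := (linearIndependent_hibi K (hP w)).comp c hc
    have heq : (fun m : S => monomialOf (fun x => genFamily K x w) m.1.1) =
        (fun m : StdMonomial (Set.Icc ⊥ w) => monomialOf
          (fun x => Ideal.Quotient.mk (hibiIdeal K (Set.Icc ⊥ w)) (X x)) m.1) ∘ c :=
      funext fun m => monomialOf_genFamily K m.2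
    rwa [← heq] at this
  -- Discarding the coefficients outside `S` changes nothing, since those monomials are zero in the
  -- stalk.
  have hfS : Finsupp.linearCombination K (fun m : StdMonomial P =>
      monomialOf (fun x => genFamily K x w) m.1) (f.filter (· ∈ S)) = 0 := by
    rw [← hf]
    refine linearCombination_congr_of_eq_zero fun n hn => Finsupp.filter_apply_pos _ _ ?_
    by_contra hnS
    exact hn (monomialOf_genFamily_eq_zero K hnS)
  have := linearIndepOn_iff.1 hli (f.filter (· ∈ S)) ?_ hfS
  · rw [← Finsupp.filter_apply_pos (· ∈ S) f hm, this]
    rfl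
  · rw [Finsupp.mem_supported]
    intro n hn
    rw [Finsupp.support_filter] at hn
    exact (Finset.mem_filter.1 hn).2

end Stalks

/-! ### The grading of the limit. -/

section Grading

variable (K : Type*) [Field K] {P : Type*} [PartialOrder P]

theorem gradedMonoid_limGrading (T : PosetAlgebra K P) :
    SetLike.GradedMonoid T.limGrading where
  one_mem x := by
    obtain ⟨_⟩ := T.graded x
    exact SetLike.GradedOne.one_mem
  mul_mem i j a b ha hb x := by
    obtain ⟨_⟩ := T.graded x
    exact SetLike.GradedMul.mul_mem (ha x) (hb x)

/-- Independence of degrees is checked in each stalk through the projection. -/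
theorem iSupIndep_limGrading (T : PosetAlgebra K P) : iSupIndep T.limGrading := by
  intro d
  rw [Submodule.disjoint_def]
  intro a ha ha'
  refine Subtype.ext (funext fun x => ?_)
  obtain ⟨_⟩ := T.graded x
  have hind := (DirectSum.Decomposition.isInternal (T.grading x)).submodule_iSupIndep d
  refine Submodule.disjoint_def.1 hind _ (ha x) ?_
  let π : T.lim →ₗ[K] T.stalk x := ((Pi.evalAlgHom K T.stalk x).comp T.lim.val).toLinearMap
  have hle : (⨆ (e) (_ : e ≠ d), T.limGrading e) ≤
      (⨆ (e) (_ : e ≠ d), T.grading x e).comap π := by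
    refine iSup₂_le fun e he b hb => ?_
    exact Submodule.mem_iSup_of_mem e (Submodule.mem_iSup_of_mem he (hb x))
  exact hle ha'

end Grading

/-! ### Gluing the stalk bases in the limit. -/

section Limit

variable (K : Type*) [Field K] {P : Type*} [PartialOrder P] [OrderBot P]

/-- The projection of `lim_P T` to the stalk at `w`. -/
noncomputable def limProj (w : P) : GenHibiRing K P →ₐ[K] HibiRing K (Set.Icc ⊥ w) :=
  (Pi.evalAlgHom K (hibiAlgebra K P).stalk w).comp (hibiAlgebra K P).lim.val

theorem limProj_gen (w x : P) : limProj K w (gen K x) = genFamily K x w := rfl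

variable {K} in
theorem limProj_ext {s t : GenHibiRing K P} (h : ∀ w, limProj K w s = limProj K w t) : s = t :=
  Subtype.ext (funext h)

theorem hibiRes_limProj {z' z : P} (h : z' ≤ z) (s : GenHibiRing K P) :
    hibiRes K h (limProj K z s) = limProj K z' s := s.2 z' z h

theorem limProj_monomialOf (w : P) (m : P →₀ ℕ) :
    limProj K w (monomialOf (gen K) m) = monomialOf (fun x => genFamily K x w) m :=
  map_monomialOf _ _ _

theorem limProj_linearCombination (w : P) (f : StdMonomial P →₀ K) :
    limProj K w (Finsupp.linearCombination K (fun m : StdMonomial P => monomialOf (gen K) m.1) f) =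
      Finsupp.linearCombination K (fun m : StdMonomial P =>
        monomialOf (fun x => genFamily K x w) m.1) f := by
  rw [Finsupp.linearCombination_apply, Finsupp.linearCombination_apply, map_finsuppSum]
  simp only [map_smul, limProj_monomialOf]

theorem hibiRes_linearCombination {z' z : P} (h : z' ≤ z) (f : StdMonomial P →₀ K) :
    hibiRes K h (Finsupp.linearCombination K (fun m : StdMonomial P =>
        monomialOf (fun x => genFamily K x z) m.1) f) =
      Finsupp.linearCombination K (fun m : StdMonomial P =>
        monomialOf (fun x => genFamily K x z') m.1) f := by
  rw [← limProj_linearCombination, ← limProj_linearCombination, hibiRes_limProj]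

theorem gen_mem_limGrading (x : P) : gen K x ∈ (hibiAlgebra K P).limGrading 1 := by
  intro z
  change genFamily K x z ∈ hibiGrading K (Set.Icc ⊥ z) 1
  by_cases h : x ≤ z
  · rw [genFamily_of_le K h]
    exact ⟨_, isWeightedHomogeneous_X K _ _, rfl⟩
  · rw [genFamily_of_not_le K h]
    exact Submodule.zero_mem _

variable [Fintype P]

theorem gen_mul_gen (hP : IsLocallyDistributive P) (x y : P) :
    gen K x * gen K y = gen K (meet x y) * ∑ z ∈ minUpperBounds x y, gen K z :=
  limProj_ext fun w => by
    simpa only [map_mul, map_sum, limProj_gen] using genFamily_mul_genFamily K hP w x y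

theorem linearIndependent_gen (hP : IsLocallyDistributive P) :
    LinearIndependent K fun m : StdMonomial P => monomialOf (gen K) m.1 := by
  rw [linearIndependent_iff]
  intro f hf
  ext m
  obtain ⟨t, ht⟩ := exists_le_iff_support_le m
  -- The stalk at the top `t` of the support already detects the coefficient of `m`.
  refine coeff_eq_zero_of_linearCombination_genFamily K hP (w := t) ?_ m ((ht t).2 le_rfl)
  rw [← limProj_linearCombination, hf, map_zero]

theorem span_gen (hP : IsLocallyDistributive P) :
    Submodule.span K (Set.range fun m : StdMonomial P => monomialOf (gen K) m.1) = ⊤ := by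
  classical
  refine eq_top_iff.2 fun s _ => ?_
  choose t ht using exists_le_iff_support_le (P := P)
  have hr : ∀ z, ∃ r : StdMonomial P →₀ K, Finsupp.linearCombination K (fun m : StdMonomial P =>
      monomialOf (fun x => genFamily K x z) m.1) r = limProj K z s := fun z => by
    refine Finsupp.mem_span_range_iff_exists_finsupp.1 ?_
    rw [span_genFamily K hP z]
    trivial
  choose r hr using hr
  -- Restricting the expansion at `z` to the stalk at `t m` gives a second expansion of the same
  -- element; the coefficients of `m`, which survives there, must agree.
  have hcompat : ∀ m z, t m ≤ z → r (t m) m = r z m := fun m z hz => by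
    rw [← sub_eq_zero, ← Finsupp.sub_apply]
    refine coeff_eq_zero_of_linearCombination_genFamily K hP (w := t m) ?_ m ((ht m _).2 le_rfl)
    rw [map_sub, hr, ← hibiRes_linearCombination K hz, hr, hibiRes_limProj, sub_self]
  -- Each coefficient is taken from the stalk at `t m`. Finiteness of `P` keeps the support finite.
  let q : StdMonomial P →₀ K := ∑ z, (r z).filter fun m => t m = z
  have hq : ∀ m, q m = r (t m) m := fun m => by
    simp only [q, Finsupp.finsetSum_apply, Finsupp.filter_apply]
    simp
  have hs : s = Finsupp.linearCombination K
      (fun m : StdMonomial P => monomialOf (gen K) m.1) q := limProj_ext fun z => by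
    rw [limProj_linearCombination, ← hr]
    refine linearCombination_congr_of_eq_zero fun m hm => ?_
    rw [hq, hcompat m z]
    refine (ht m z).1 ?_
    by_contra h
    exact hm (monomialOf_genFamily_eq_zero K h)
  rw [hs]
  exact Finsupp.mem_span_range_iff_exists_finsupp.2 ⟨q, rfl⟩

theorem isASLOnOp_gen (hP : IsLocallyDistributive P) :
    IsASLOnOp K (gen K : P → GenHibiRing K P) :=
  isASLOnOp_of_mul_eq hP (gen_mul_gen K hP) (linearIndependent_gen K hP) (span_gen K hP)

theorem gradedAlgebra_limGrading (hP : IsLocallyDistributive P) :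
    Nonempty (GradedAlgebra (hibiAlgebra K P).limGrading) := by
  classical
  have hm := gradedMonoid_limGrading K (hibiAlgebra K P)
  have hint : DirectSum.IsInternal (hibiAlgebra K P).limGrading := by
    rw [DirectSum.isInternal_submodule_iff_iSupIndep_and_iSup_eq_top]
    refine ⟨iSupIndep_limGrading K _, ?_⟩
    rw [eq_top_iff, ← span_gen K hP, Submodule.span_le]
    rintro _ ⟨m, rfl⟩
    -- The degree of a standard monomial is its total exponent, so the homogeneous parts contain a
    -- spanning set.
    refine Submodule.mem_iSup_of_mem (∑ x ∈ m.1.support, m.1 x • (1 : ℤ)) ?_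
    exact SetLike.prod_mem_graded _ _ _ fun x _ =>
      SetLike.pow_mem_graded _ (gen_mem_limGrading K x)
  let := hint.chooseDecomposition
  exact ⟨{ hm, hint.chooseDecomposition with }⟩

theorem aeval_gen_surjective (hP : IsLocallyDistributive P) :
    Function.Surjective (aeval (gen K) : MvPolynomial P K →ₐ[K] GenHibiRing K P) := by
  rw [← AlgHom.coe_toLinearMap, ← LinearMap.range_eq_top, eq_top_iff, ← span_gen K hP,
    Submodule.span_le]
  rintro _ ⟨m, rfl⟩
  exact ⟨monomial m.1 1, aeval_monomial_one _ _⟩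

/-- Modulo the relations, an element of the kernel is a combination of standard monomials. Its image
in the limit is zero, so independence there kills every coefficient. -/
theorem ker_aeval_gen (hP : IsLocallyDistributive P) :
    RingHom.ker (aeval (gen K) : MvPolynomial P K →ₐ[K] GenHibiRing K P) =
      Ideal.span {f | ∃ x y : P, f = relation K x y} := by
  set J := Ideal.span {f | ∃ x y : P, f = relation K x y} with hJ
  have hle : J ≤ RingHom.ker (aeval (gen K) : MvPolynomial P K →ₐ[K] GenHibiRing K P) := by
    refine Ideal.span_le.2 ?_
    rintro _ ⟨x, y, rfl⟩
    change aeval (gen K) (relation K x y) = 0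
    simp only [relation, map_sub, map_mul, map_sum, aeval_X]
    rw [gen_mul_gen K hP, sub_self]
  refine le_antisymm (fun f hf => ?_) hle
  let φ : P → MvPolynomial P K ⧸ J := fun x => Ideal.Quotient.mk J (X x)
  have hφ : ∀ x y, φ x * φ y = φ (meet x y) * ∑ z ∈ minUpperBounds x y, φ z := fun x y => by
    rw [← sub_eq_zero]
    have : Ideal.Quotient.mk J (relation K x y) = 0 :=
      Ideal.Quotient.eq_zero_iff_mem.2 (Ideal.subset_span ⟨x, y, rfl⟩)
    simpa only [relation, map_sub, map_mul, map_sum] using this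
  have haeval : (aeval φ : MvPolynomial P K →ₐ[K] _) = Ideal.Quotient.mkₐ K J :=
    MvPolynomial.algHom_ext fun x => by rw [aeval_X]; rfl
  have hmem := aeval_mem_span (K := K) (mul_mem_span_of_mul_eq hφ) f
  obtain ⟨r, hr⟩ := Finsupp.mem_span_range_iff_exists_finsupp.1 hmem
  let g : MvPolynomial P K ⧸ J →ₐ[K] GenHibiRing K P := Ideal.Quotient.liftₐ J (aeval (gen K)) hle
  have hgφ : ∀ x, g (φ x) = gen K x := fun x => aeval_X _ x
  have hg : g (aeval φ f) = 0 := by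
    rw [haeval]
    exact hf
  rw [← hr, map_finsuppSum] at hg
  simp only [map_smul, map_monomialOf, hgφ] at hg
  have hr0 : r = 0 := linearIndependent_iff.1 (linearIndependent_gen K hP) r hg
  rw [hr0, Finsupp.sum_zero_index, haeval] at hr
  exact Ideal.Quotient.eq_zero_iff_mem.1 hr.symm

/-- The generating sets themselves coincide: with no common upper bound the sum is empty, and with
one the meet exists. -/
theorem stanleyIdeal_eq (hP : IsLocallyDistributive P) :
    stanleyIdeal K P = Ideal.span {f | ∃ x y : P, f = relation K x y} := by
  have hbdd : ∀ {x y w : P}, w ∈ upperBounds {x, y} ↔ x ≤ w ∧ y ≤ w := by simp [upperBounds]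
  have hempty : ∀ {x y : P}, ¬ BddAbove {x, y} → relation K x y = X x * X y := by
    intro x y h
    have : minUpperBounds x y = ∅ := Finset.eq_empty_of_forall_notMem fun z hz =>
      h ⟨z, hbdd.2 (mem_minUpperBounds.1 hz).1⟩
    rw [relation, this, Finset.sum_empty, mul_zero, sub_zero]
  refine congrArg Ideal.span (Set.ext fun f => ⟨?_, ?_⟩)
  · rintro (⟨x, y, h, rfl⟩ | ⟨x, y, m, -, hm, rfl⟩)
    · exact ⟨x, y, (hempty h).symm⟩
    · exact ⟨x, y, by rw [relation, meet_eq_of_isGLB hm]⟩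
  · rintro ⟨x, y, rfl⟩
    by_cases h : BddAbove {x, y}
    · obtain ⟨w, hw⟩ := h
      obtain ⟨m, hm⟩ := hP.exists_isGLB (hbdd.1 hw).1 (hbdd.1 hw).2
      exact Or.inr ⟨x, y, m, ⟨w, hw⟩, hm, by rw [relation, meet_eq_of_isGLB hm]⟩
    · exact Or.inl ⟨x, y, h, hempty h⟩

/-- `lim_P T` is the quotient of `K[P]` by Stanley's relations. -/
theorem exists_algEquiv_stanleyRing (hP : IsLocallyDistributive P) :
    ∃ e : GenHibiRing K P ≃ₐ[K] StanleyRing K P,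
      ∀ x : P, e (gen K x) = Ideal.Quotient.mk (stanleyIdeal K P) (X x) := by
  let e₁ := Ideal.quotientKerAlgEquivOfSurjective (aeval_gen_surjective K hP)
  let e₂ := Ideal.quotientEquivAlgOfEq K ((stanleyIdeal_eq K hP).trans (ker_aeval_gen K hP).symm)
  refine ⟨(e₂.trans e₁).symm, fun x => ?_⟩
  rw [AlgEquiv.symm_apply_eq]
  exact (aeval_X (gen K) x).symm

end Limit

variable {K : Type*} [Field K] {P : Type*} [PartialOrder P]

theorem IsASLOnOp.map_algEquiv {R S : Type*} [CommRing R] [Algebra K R] [CommRing S] [Algebra K S]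
    {φ : P → R} (h : IsASLOnOp K φ) (e : R ≃ₐ[K] S) : IsASLOnOp K fun x => e (φ x) where
  injective := e.injective.comp h.injective
  linearIndependent := by
    simp only [← map_monomialOf]
    exact h.linearIndependent.map' e.toLinearMap
      (LinearMap.ker_eq_bot.2 e.injective)
  span_eq_top := by
    have := congrArg (Submodule.map e.toLinearMap) h.span_eq_top
    rw [Submodule.map_span, ← Set.range_comp, Submodule.map_top,
      LinearMap.range_eq_top.2 e.surjective] at this
    simp only [← map_monomialOf]
    exact this
  straightening x y hxy hyx r hr := by
    refine h.straightening x y hxy hyx r (e.injective ?_)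
    rw [map_mul, hr, map_finsuppSum]
    simp only [map_smul, map_monomialOf]

end GenHibi

theorem corollary4p3 {K : Type*} [Field K] {P : Type*} [PartialOrder P] [OrderBot P] [Fintype P]
    (hP : GenHibi.IsLocallyDistributive P) :
    -- `lim_P T` is a `ℤ`-graded ASL on `P^op`, all elements of `P` having degree `1`
    GenHibi.IsGradedASLOnOp K (GenHibi.hibiAlgebra K P).limGrading
      (GenHibi.gen K : P → GenHibi.GenHibiRing K P) ∧
    (∀ x : P, GenHibi.gen K x ∈ (GenHibi.hibiAlgebra K P).limGrading 1) ∧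
    -- `lim_P T = K[P] / I_T`, where `I_T` is generated by the listed relations
    Function.Surjective
      (MvPolynomial.aeval (GenHibi.gen K) : MvPolynomial P K →ₐ[K] GenHibi.GenHibiRing K P) ∧
    RingHom.ker
      (MvPolynomial.aeval (GenHibi.gen K) : MvPolynomial P K →ₐ[K] GenHibi.GenHibiRing K P) =
      Ideal.span {f | ∃ x y : P, f = GenHibi.relation K x y} ∧
    -- for simplicial posets it is Stanley's ring, with the same ASL structure
    (GenHibi.IsSimplicialPoset P →
      GenHibi.IsASLOnOp K
        (fun x : P => Ideal.Quotient.mk (GenHibi.stanleyIdeal K P) (MvPolynomial.X x)) ∧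
      ∃ e : GenHibi.GenHibiRing K P ≃ₐ[K] GenHibi.StanleyRing K P,
        ∀ x : P, e (GenHibi.gen K x) =
          Ideal.Quotient.mk (GenHibi.stanleyIdeal K P) (MvPolynomial.X x)) := by
  refine ⟨⟨GenHibi.isASLOnOp_gen K hP, GenHibi.gradedAlgebra_limGrading K hP,
    fun x => ⟨1, one_pos, GenHibi.gen_mem_limGrading K x⟩⟩, GenHibi.gen_mem_limGrading K,
    GenHibi.aeval_gen_surjective K hP, GenHibi.ker_aeval_gen K hP, fun _ => ?_⟩
  obtain ⟨e, he⟩ := GenHibi.exists_algEquiv_stanleyRing K hP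
  refine ⟨?_, e, he⟩
  simpa only [he] using (GenHibi.isASLOnOp_gen K hP).map_algEquiv e
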